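/- Let $T=(V,E)$ be a finite tree, let $S\subseteq V$ be a set of $m\ge 2$ vertices, and let $E^{\pm}$ be the set of all arcs $(i,j)$ with $\{i,j\}\in E$ (both orientations of every edge of $T$). An *$S$-catalyst* for $T$ is a pair $\kappa=(\sigma,f)$, where $\sigma$ is a permutation of $S$ and $f:S\to E^{\pm}$ is a map such that, for every $i\in S$, the arc $f(i)$ lies on the path of $T$ from $i$ to $\sigma(i)$ and is oriented according to this path; its sign is $\operatorname{sgn}(\kappa)=\operatorname{sgn}(\sigma)$. An *$m$-arrowflow* on $T$ is a directed multigraph with vertex set $V$ and $m$ arcs, counted with multiplicity, all of which belong to $E^{\pm}$. For an $m$-arrowflow $A$, let $C_S(A)$ be the set of $S$-catalysts $(\sigma,f)$ for which the multiset $\{\!\{f(i) : i\in S\}\!\}$ is the arc multiset of $A$. The *missing forest* of $A$ is the graph with vertex set $V$ whose edges are the edges $\{u,v\}$ of $T$ such that neither $(u,v)$ nor $(v,u)$ is an arc of $A$. A spanning forest of $T$ (an acyclic subgraph of $T$ containing every vertex) is *$S$-rooted* if it has exactly $m$ connected components and each of them contains exactly one vertex of $S$. An $m$-arrowflow is *unital*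 (for $S$) if no arc appears in it with multiplicity at least $2$ and its missing forest is $S$-rooted. Then: 1. For every unital $m$-arrowflow $A$ on $T$, $$\sum_{\kappa\in C_S(A)}\operatorname{sgn}(\kappa)=(-1)^{m-1}.$$ 2. For every $S$-rooted spanning forest $F$ of $T$, the number of unital $m$-arrowflows on $T$ whose missing forest is $F$ is $(m-1)2^{m-2}$. -/

import Mathlib

namespace TreeCatalyst

open SimpleGraph

variable {V : Type*}

/-- An `S`-catalyst for a tree `T`: a permutation `σ` of `S` and a map `f` from `S` to the arcs
supported on `T` (its darts, that is, oriented edges) such that, for each `i` in `S`, the arc `f i`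
lies in the path of `T` from `i` to `σ i` and is oriented according to this path. -/
def IsCatalyst (T : SimpleGraph V) (S : Finset V) (κ : Equiv.Perm S × (S → T.Dart)) : Prop :=
  ∀ i : S, ∃ p : T.Walk (i : V) (κ.1 i : V), p.IsPath ∧ κ.2 i ∈ p.darts

/-- A `k`-arrowflow on `T`: a directed multigraph on the vertices of `T` with `k` arcs (counted with
multiplicity), all supported on edges of `T`; it is given by its multiset of `k` arcs. -/
abbrev Arrowflow (T : SimpleGraph V) (k : ℕ) : Type _ := Sym T.Dart k

/-- The arc multiset `{{ f i | i ∈ S }}` of the arrowflow induced by a catalyst `(σ, f)`. -/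
def inducedArcs (T : SimpleGraph V) (S : Finset V) (κ : Equiv.Perm S × (S → T.Dart)) :
    Multiset T.Dart :=
  (Finset.univ : Finset S).val.map κ.2

open Classical in
/-- The arrowflow class of `A` for `S`: the set of `S`-catalysts for `T` that induce `A`. -/
noncomputable def catalystClass [Fintype V] (T : SimpleGraph V) (S : Finset V)
    (A : Arrowflow T S.card) : Finset (Equiv.Perm S × (S → T.Dart)) :=
  Finset.univ.filter fun κ =>
    IsCatalyst T S κ ∧ inducedArcs T S κ = (A : Multiset T.Dart)

/-- The underlying simple graph of an arrowflow (with the full vertex set). -/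
def underlyingGraph (T : SimpleGraph V) {k : ℕ} (A : Arrowflow T k) : SimpleGraph V :=
  SimpleGraph.fromEdgeSet {e | ∃ a : T.Dart, a ∈ (A : Multiset T.Dart) ∧ a.edge = e}

/-- The missing forest of an arrowflow: the complement in `T` of its underlying simple graph. -/
def missingForest (T : SimpleGraph V) {k : ℕ} (A : Arrowflow T k) : SimpleGraph V :=
  T \ underlyingGraph T A

/-- An `S`-rooted spanning forest of `T`: an acyclic subgraph of `T` containing every vertex, with
`|S|` connected components, each of which has exactly one vertex in `S`. -/
structure IsRootedForest (T : SimpleGraph V) (S : Finset V) (F : SimpleGraph V) : Prop where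
  le : F ≤ T
  acyclic : F.IsAcyclic
  card_components : Nat.card F.ConnectedComponent = S.card
  existsUnique_root : ∀ c : F.ConnectedComponent, ∃! s : V, s ∈ S ∧ s ∈ c.supp

open Classical in
/-- An arrowflow has parallel arrows if some arc appears in it with multiplicity at least two. -/
def HasParallelArrows (T : SimpleGraph V) {k : ℕ} (A : Arrowflow T k) : Prop :=
  ∃ a : T.Dart, 2 ≤ (A : Multiset T.Dart).count a

/-- An `|S|`-arrowflow is unital for `S` if it has no parallel arrows and its missing forest is
`S`-rooted. -/
def IsUnital (T : SimpleGraph V) (S : Finset V) (A : Arrowflow T S.card) : Prop :=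
  ¬ HasParallelArrows T A ∧ IsRootedForest T S (missingForest T A)

end TreeCatalyst

/-! An `S`-rooted missing forest leaves `m - 1` edges of `T`, so the `m` distinct arcs of a unital
arrowflow cover `m - 1` edges and exactly one edge carries both orientations.

Let `X` be the 0/1 matrix, arcs by `S`, marking the vertices on the tail side of each arc. An arc
lies on the path from `i` to `σ i` iff `i` is on its tail side and `σ i` is not. A catalyst inducing
`A` is thus a pair of permutations `(π, σ)` with `X (π i) i = 1` and `X (π i) (σ i) = 0` for all
`i`, and the signed sum is `det X * det (J - X)`, with `J` all ones (`sum_sign_catalystClass`). The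
two opposite arcs have rows summing to the all-ones row, so `det (J - X) = (-1)^(m-1) * det X`
(`det_one_sub_of_row_add_row`). Rootedness makes `X` unimodular (`isUnit_tailMatrix`), so `(det X)^2
= 1`.

For the count, choose the doubled edge and orient each of the other `m - 2`. -/

namespace TreeCatalyst

open SimpleGraph

/-! ### Component counts in forests, and tail sides of darts in a tree. -/

section Graph

variable {V : Type*} {G : SimpleGraph V}

lemma reachable_deleteEdge_cases {u v x y : V} (h : G.Reachable x y) :
    (G.deleteEdges {s(u, v)}).Reachable x y ∨
      ((G.deleteEdges {s(u, v)}).Reachable x u ∧ (G.deleteEdges {s(u, v)}).Reachable v y) ∨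
      ((G.deleteEdges {s(u, v)}).Reachable x v ∧ (G.deleteEdges {s(u, v)}).Reachable u y) := by
  obtain ⟨p⟩ := h
  induction p with
  | nil => exact Or.inl .rfl
  | @cons x z y hxz p ih =>
    by_cases he : s(x, z) = s(u, v)
    · rcases Sym2.eq_iff.1 he with ⟨rfl, rfl⟩ | ⟨rfl, rfl⟩
      · rcases ih with h | ⟨-, h⟩ | ⟨-, h⟩
        · exact Or.inr (Or.inl ⟨.rfl, h⟩)
        · exact Or.inr (Or.inl ⟨.rfl, h⟩)
        · exact Or.inl h
      · rcases ih with h | ⟨-, h⟩ | ⟨-, h⟩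
        · exact Or.inr (Or.inr ⟨.rfl, h⟩)
        · exact Or.inl h
        · exact Or.inr (Or.inr ⟨.rfl, h⟩)
    · have hr : (G.deleteEdges {s(u, v)}).Reachable x z :=
        Adj.reachable (by simpa [deleteEdges_adj] using ⟨hxz, by simpa using he⟩)
      rcases ih with h | ⟨h, h'⟩ | ⟨h, h'⟩
      · exact Or.inl (hr.trans h)
      · exact Or.inr (Or.inl ⟨hr.trans h, h'⟩)
      · exact Or.inr (Or.inr ⟨hr.trans h, h'⟩)

/-- The components after deletion, other than that of `v`, correspond bijectively to the old
components. -/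
lemma card_connectedComponent_deleteEdge [Finite V] {u v : V} (huv : G.Adj u v)
    (hb : G.IsBridge s(u, v)) :
    Nat.card (G.deleteEdges {s(u, v)}).ConnectedComponent =
      Nat.card G.ConnectedComponent + 1 := by
  classical
  rw [isBridge_iff] at hb
  set H := G.deleteEdges {s(u, v)} with hH
  have hle : H ≤ G := deleteEdges_le _
  let f : {c : H.ConnectedComponent // c ≠ H.connectedComponentMk v} → G.ConnectedComponent :=
    fun c ↦ c.1.map (Hom.ofLE hle)
  have hf : Function.Bijective f := by
    constructor
    · rintro ⟨c, hc⟩ ⟨d, hd⟩ hcd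
      induction c using ConnectedComponent.ind with | _ x
      induction d using ConnectedComponent.ind with | _ y
      have hxy : G.Reachable x y := ConnectedComponent.exact hcd
      rw [Ne, ConnectedComponent.eq] at hc hd
      rw [Subtype.mk.injEq, ConnectedComponent.eq]
      rcases reachable_deleteEdge_cases (u := u) (v := v) hxy with h | ⟨-, h⟩ | ⟨h, -⟩
      · exact h
      · exact absurd h.symm hd
      · exact absurd h hc
    · intro c
      induction c using ConnectedComponent.ind with | _ x
      by_cases hx : H.Reachable x v
      · refine ⟨⟨H.connectedComponentMk u, ?_⟩, ?_⟩
        · rwa [Ne, ConnectedComponent.eq]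
        · exact ConnectedComponent.sound (huv.reachable.trans (hx.mono hle).symm)
      · exact ⟨⟨H.connectedComponentMk x, by rwa [Ne, ConnectedComponent.eq]⟩, rfl⟩
  have := Fintype.ofFinite H.ConnectedComponent
  rw [← Nat.card_eq_of_bijective f hf, Nat.card_eq_fintype_card, Nat.card_eq_fintype_card,
    Fintype.card_subtype_compl, Fintype.card_subtype_eq]
  have : 0 < Fintype.card H.ConnectedComponent := Fintype.card_pos_iff.2 ⟨H.connectedComponentMk v⟩
  omega

lemma card_connectedComponent_add_card_edgeSet [Finite V] (hG : G.IsAcyclic) :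
    Nat.card G.ConnectedComponent + G.edgeSet.ncard = Nat.card V := by
  induction hn : G.edgeSet.ncard generalizing G with
  | zero =>
    have h0 : G.edgeSet = ∅ := (Set.ncard_eq_zero (Set.toFinite _)).1 hn
    rw [edgeSet_eq_empty] at h0
    subst h0
    refine (Nat.card_eq_of_bijective (fun x ↦ connectedComponentMk ⊥ x) ⟨fun x y h ↦ ?_,
      fun c ↦ ?_⟩).symm
    · simpa using ConnectedComponent.exact h
    · exact c.exists_rep
  | succ n ih =>
    obtain ⟨e, he⟩ : G.edgeSet.Nonempty := by
      rw [← Set.ncard_pos (Set.toFinite _)]; omega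
    induction e with | _ u v
    have hc := card_connectedComponent_deleteEdge (u := u) (v := v) he (isAcyclic_iff_forall_adj_isBridge.1 hG he)
    have hd := ih (hG.anti (deleteEdges_le {s(u, v)})) (by
      rw [edgeSet_deleteEdges, Set.ncard_sdiff_singleton_of_mem he, hn]; rfl)
    rw [← hd, hc]
    ring

/-- The vertices on the tail side of a dart: those joined to its tail when its edge is deleted. -/
def TailSide (G : SimpleGraph V) (a : G.Dart) (x : V) : Prop :=
  (G.deleteEdges {a.edge}).Reachable x a.fst

lemma tailSide_symm (hG : G.IsTree) (a : G.Dart) (x : V) :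
    TailSide G a.symm x ↔ ¬ TailSide G a x := by
  obtain ⟨⟨u, v⟩, huv⟩ := a
  have hb := isBridge_iff.1 (isAcyclic_iff_forall_adj_isBridge.1 hG.isAcyclic huv)
  simp only [TailSide, Dart.symm, Dart.edge, Prod.swap, Sym2.eq_swap (a := v)]
  change (G.deleteEdges {s(u, v)}).Reachable x v ↔ ¬ (G.deleteEdges {s(u, v)}).Reachable x u
  constructor
  · exact fun h h' ↦ hb (h'.symm.trans h)
  · intro h
    rcases reachable_deleteEdge_cases (u := u) (v := v) (hG.connected x u) with h' | ⟨h', -⟩ | ⟨h', -⟩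
    · exact absurd h' h
    · exact absurd h' h
    · exact h'

lemma tailSide_fst (a : G.Dart) : TailSide G a a.fst := Reachable.rfl

lemma not_tailSide_snd (hG : G.IsTree) (a : G.Dart) : ¬ TailSide G a a.snd :=
  (tailSide_symm hG a _).1 (tailSide_fst a.symm)

lemma tailSide_congr_of_adj {a : G.Dart} {x y : V} (h : G.Adj x y) (he : s(x, y) ≠ a.edge) :
    TailSide G a x ↔ TailSide G a y := by
  have hr : (G.deleteEdges {a.edge}).Reachable x y :=
    Adj.reachable (by simpa [deleteEdges_adj] using ⟨h, he⟩)
  exact ⟨fun h ↦ hr.symm.trans h, fun h ↦ hr.trans h⟩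

lemma tailSide_congr_of_reachable {F : SimpleGraph V} (hF : F ≤ G) {a : G.Dart}
    (ha : a.edge ∉ F.edgeSet) {x y : V} (h : F.Reachable x y) :
    TailSide G a x ↔ TailSide G a y := by
  obtain ⟨p⟩ := h
  induction p with
  | nil => rfl
  | cons hxz p ih =>
    exact (tailSide_congr_of_adj (hF hxz) (fun he ↦ ha (he ▸ hxz))).trans ih

lemma mem_darts_of_tailSide (hG : G.IsTree) {a : G.Dart} {x y : V} (p : G.Walk x y)
    (hx : TailSide G a x) (hy : ¬ TailSide G a y) : a ∈ p.darts := by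
  induction p with
  | nil => exact absurd hx hy
  | @cons x z y h p ih =>
    rw [Walk.darts_cons, List.mem_cons]
    by_cases he : s(x, z) = a.edge
    · rcases (dart_edge_eq_iff ⟨(x, z), h⟩ a).1 he with h' | h'
      · exact Or.inl h'.symm
      · have hx' : x = a.snd := congrArg (fun d : G.Dart ↦ d.fst) h'
        exact absurd (hx' ▸ hx) (not_tailSide_snd hG a)
    · exact Or.inr (ih ((tailSide_congr_of_adj h he).1 hx) hy)

lemma tailSide_of_mem_darts (hG : G.IsTree) {a : G.Dart} {x y : V} {p : G.Walk x y}
    (hp : p.IsTrail) (ha : a ∈ p.darts) : TailSide G a x ∧ ¬ TailSide G a y := by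
  induction p with
  | nil => simp at ha
  | @cons x z y h p ih =>
    rw [Walk.isTrail_cons] at hp
    rw [Walk.darts_cons, List.mem_cons] at ha
    rcases ha with rfl | ha
    · refine ⟨tailSide_fst _, fun hy ↦ ?_⟩
      have hz := not_tailSide_snd hG ⟨(x, z), h⟩
      -- If `y` were on the tail side, the rest of the walk would have to cross the same edge back,
      -- which a trail cannot do.
      have : TailSide G (⟨(x, z), h⟩ : G.Dart).symm z := tailSide_fst _
      apply hp.2
      have hm := mem_darts_of_tailSide hG p this (by
        rw [tailSide_symm hG]; exact not_not.2 hy)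
      have := List.mem_map_of_mem (f := Dart.edge) hm
      rwa [Dart.edge_symm] at this
    · obtain ⟨h1, h2⟩ := ih hp.1 ha
      refine ⟨(tailSide_congr_of_adj h fun he ↦ hp.2 ?_).2 h1, h2⟩
      rw [he]
      exact List.mem_map_of_mem ha

/-- This splits the path condition into separate conditions on the two endpoints, so that it can be
read off matrix entries. -/
lemma exists_isPath_mem_darts_iff (hG : G.IsTree) {a : G.Dart} {x y : V} :
    (∃ p : G.Walk x y, p.IsPath ∧ a ∈ p.darts) ↔ TailSide G a x ∧ ¬ TailSide G a y := by
  constructor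
  · rintro ⟨p, hp, ha⟩
    exact tailSide_of_mem_darts hG hp.isTrail ha
  · rintro ⟨hx, hy⟩
    obtain ⟨p, hp⟩ := (hG.connected x y).exists_isPath
    exact ⟨p, hp, mem_darts_of_tailSide hG p hx hy⟩

end Graph

/-! ### Two determinant identities. -/

section Det

variable {n : Type*} [Fintype n] [DecidableEq n]

/-- With `v = e_a + e_b` the hypothesis says that `vᵀ X` is the all-ones row, so `J - X = -(1 - 𝟙
vᵀ) X`. The rank-one update has determinant `1 - 2 = -1`. -/
lemma det_one_sub_of_row_add_row (X : Matrix n n ℤ) {a b : n}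
    (h : ∀ j, X a j + X b j = 1) :
    (Matrix.of fun i j ↦ 1 - X i j).det = (-1) ^ (Fintype.card n - 1) * X.det := by
  set v : n → ℤ := Pi.single a 1 + Pi.single b 1 with hv
  have hM : (Matrix.of fun i j ↦ 1 - X i j) =
      -(1 + Matrix.replicateCol Unit (fun _ : n ↦ (1 : ℤ)) * Matrix.replicateRow Unit (-v)) * X := by
    ext i j
    rw [neg_mul, Matrix.add_mul, Matrix.one_mul, Matrix.mul_assoc, Matrix.neg_apply,
      Matrix.add_apply, Matrix.mul_apply]
    simp [Matrix.mul_apply, hv, add_mul, Finset.sum_add_distrib, Pi.single_apply]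
    linarith [h j]
  rw [hM, Matrix.det_mul, Matrix.det_neg, Matrix.det_one_add_replicateCol_mul_replicateRow]
  have : (-v) ⬝ᵥ (fun _ : n ↦ (1 : ℤ)) = -2 := by
    simp [dotProduct, hv, Finset.sum_add_distrib]
  rw [this]
  obtain ⟨k, hk⟩ : ∃ k, Fintype.card n = k + 1 :=
    Nat.exists_eq_succ_of_ne_zero (Fintype.card_pos_iff.2 ⟨a⟩).ne'
  rw [hk, Nat.add_sub_cancel, pow_succ]
  ring

/-- Expand `Y` over `τ` and substitute `σ = τ * π`; the two signs multiply to that of `σ`. -/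
lemma det_mul_det_eq_sum (X Y : Matrix n n ℤ) :
    X.det * Y.det = ∑ π : Equiv.Perm n, ∑ σ : Equiv.Perm n,
      (Equiv.Perm.sign σ : ℤ) * ∏ i, (X (π i) i * Y (π i) (σ i)) := by
  rw [← Matrix.det_transpose Y, Matrix.det_apply, Finset.sum_mul]
  refine Finset.sum_congr rfl fun π _ ↦ ?_
  rw [Matrix.det_apply, Finset.mul_sum]
  refine Fintype.sum_equiv (Equiv.mulRight π) _ _ fun τ ↦ ?_
  rw [Finset.prod_mul_distrib]
  have : ∏ i, Y (π i) ((Equiv.mulRight π τ) i) = ∏ i, Y.transpose (τ i) i :=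
    Equiv.prod_comp π fun i ↦ Y i (τ i)
  rw [this]
  simp only [Equiv.coe_mulRight, Equiv.Perm.sign_mul, Units.smul_def, smul_eq_mul, Units.val_mul]
  ring

end Det

/-! ### Unital arrowflows and the signed sum over their catalysts. -/

section Arrowflow

variable {V : Type*} {T : SimpleGraph V}

lemma edgeSet_missingForest {k : ℕ} (A : Arrowflow T k) :
    (missingForest T A).edgeSet =
      T.edgeSet \ {e | ∃ a : T.Dart, a ∈ (A : Multiset T.Dart) ∧ a.edge = e} := by
  ext e
  simp only [missingForest, underlyingGraph, edgeSet_sdiff, edgeSet_fromEdgeSet, Set.mem_sdiff,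
    Set.mem_ofPred_eq]
  refine and_congr_right fun he ↦ not_congr (and_iff_left ?_)
  exact not_isDiag_of_mem_edgeSet T he

lemma not_hasParallelArrows_iff {k : ℕ} (A : Arrowflow T k) :
    ¬ HasParallelArrows T A ↔ (A : Multiset T.Dart).Nodup := by
  classical
  rw [Multiset.nodup_iff_count_le_one, HasParallelArrows, not_exists]
  refine forall_congr' fun a ↦ ?_
  rw [not_le, Nat.lt_succ_iff]

lemma card_edgeSet_sdiff_of_isRootedForest [Finite V] (hT : T.IsTree) {S : Finset V}
    {F : SimpleGraph V} (hF : IsRootedForest T S F) :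
    (T.edgeSet \ F.edgeSet).ncard + 1 = S.card := by
  have h1 := card_connectedComponent_add_card_edgeSet hT.isAcyclic
  have h2 := card_connectedComponent_add_card_edgeSet hF.acyclic
  have := hT.connected.preconnected.subsingleton_connectedComponent
  have := hT.connected.nonempty
  have : Nonempty T.ConnectedComponent := this.map T.connectedComponentMk
  rw [Nat.card_unique] at h1
  rw [hF.card_components] at h2
  have h3 := Set.ncard_sdiff_add_ncard_of_subset (edgeSet_mono hF.le) (Set.toFinite _)
  omega

/-- By pigeonhole two darts share an edge. Erasing one leaves as many darts as edges, so the edge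
map becomes injective and no second opposite pair exists. -/
lemma exists_symm_mem_of_card_image_edge [DecidableEq V] {D : Finset T.Dart}
    (hD : (D.image Dart.edge).card + 1 = D.card) :
    ∃ a ∈ D, a.symm ∈ D ∧ ∀ c ∈ D, c ≠ a → c ≠ a.symm → c.symm ∉ D := by
  classical
  obtain ⟨a, ha, b, hb, hab, he⟩ := Finset.exists_ne_map_eq_of_card_lt_of_maps_to
    (t := D.image Dart.edge) (by omega) (fun x hx ↦ Finset.mem_image_of_mem Dart.edge hx)
  obtain rfl : b = a.symm := by
    rcases (dart_edge_eq_iff b a).1 he.symm with h | h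
    · exact absurd h.symm hab
    · exact h
  refine ⟨a, ha, hb, fun c hc hca hca' hcs ↦ ?_⟩
  have himg : (D.erase a).image Dart.edge = D.image Dart.edge := by
    refine (Finset.image_subset_image (Finset.erase_subset _ _)).antisymm fun e h ↦ ?_
    obtain ⟨d, hd, rfl⟩ := Finset.mem_image.1 h
    by_cases hda : d = a
    · subst hda
      exact Finset.mem_image.2 ⟨d.symm, Finset.mem_erase.2 ⟨hab.symm, hb⟩, d.edge_symm⟩
    · exact Finset.mem_image_of_mem _ (Finset.mem_erase.2 ⟨hda, hd⟩)
  have hinj : Set.InjOn Dart.edge (D.erase a : Set T.Dart) := by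
    rw [← Finset.card_image_iff, himg, Finset.card_erase_of_mem ha]
    omega
  have hcs' : c.symm ≠ a := fun h ↦ hca' (by rw [← h, Dart.symm_symm])
  exact c.symm_ne (hinj (Finset.mem_coe.2 (Finset.mem_erase.2 ⟨hcs', hcs⟩))
    (Finset.mem_coe.2 (Finset.mem_erase.2 ⟨hca, hc⟩)) c.edge_symm)

open Classical in
/-- The matrix, with rows indexed by a family of darts, whose entries indicate the vertices on the
tail sides of the darts. -/
noncomputable def tailMatrix {ι κ : Type*} (d : ι → T.Dart) (x : κ → V) : Matrix ι κ ℤ :=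
  Matrix.of fun j i ↦ if TailSide T (d j) (x i) then 1 else 0

/-- The integer span of the columns contains every standard basis vector. -/
lemma isUnit_tailMatrix [DecidableEq V] (hT : T.IsTree) {S : Finset V} {F : SimpleGraph V}
    (hF : IsRootedForest T S F) {d : S → T.Dart} (hd : Function.Injective d)
    (hdF : ∀ j, (d j).edge ∉ F.edgeSet) {j₁ j₂ : S} (hj : d j₂ = (d j₁).symm)
    (hs : ∀ j, j ≠ j₁ → j ≠ j₂ → ∀ i, d i ≠ (d j).symm) :
    IsUnit (tailMatrix d (fun s : S ↦ (s : V))) := by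
  classical
  set X := tailMatrix d (fun s : S ↦ (s : V)) with hX
  let col : V → S → ℤ := fun x j ↦ if TailSide T (d j) x then 1 else 0
  -- Tail sides are constant on components of `F`, so the column of any vertex is that of its root
  -- in `S`.
  have hcol : ∀ x, col x ∈ LinearMap.range X.mulVecLin := by
    intro x
    obtain ⟨s, ⟨hsS, hsx⟩, -⟩ := hF.existsUnique_root (F.connectedComponentMk x)
    have hr : F.Reachable x s := (ConnectedComponent.exact hsx).symm
    refine ⟨Pi.single ⟨s, hsS⟩ 1, ?_⟩
    ext j
    simp only [Matrix.mulVecLin_apply, Matrix.mulVec_single_one, Matrix.col_apply, hX, tailMatrix,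
      Matrix.of_apply, col, tailSide_congr_of_reachable hF.le (hdF j) hr]
  have hsub : ∀ j i, i ≠ j → d i ≠ (d j).symm → col (d j).fst i = col (d j).snd i := by
    intro j i hij hi
    have he : s((d j).fst, (d j).snd) ≠ (d i).edge := by
      intro h
      rcases (dart_edge_eq_iff (d i) (d j)).1 h.symm with h | h
      · exact hij (hd h)
      · exact hi h
    simp only [col, tailSide_congr_of_adj (d j).adj he]
  have hone : ∀ j, col (d j).fst j = 1 := fun j ↦ if_pos (tailSide_fst _)
  have hzero : ∀ j, col (d j).snd j = 0 := fun j ↦ if_neg (not_tailSide_snd hT _)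
  have hj12 : j₁ ≠ j₂ := by
    rintro rfl
    exact (d j₁).symm_ne hj.symm
  -- Crossing an edge used in one direction only changes a single coordinate.
  have hsingle : ∀ j, j ≠ j₁ → j ≠ j₂ → Pi.single j 1 ∈ LinearMap.range X.mulVecLin := by
    intro j h1 h2
    convert Submodule.sub_mem _ (hcol (d j).fst) (hcol (d j).snd) using 1
    ext i
    rcases eq_or_ne i j with rfl | hij
    · simp [hone, hzero]
    · simp [hij, hsub j i hij (hs j h1 h2 i)]
  -- At an end of the doubled edge exactly one of the two opposite coordinates is 1; the others are
  -- cleared using `hsingle`.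
  have hdouble : ∀ x j, (j = j₁ ∨ j = j₂) → col x j = 1 → (∀ i, (i = j₁ ∨ i = j₂) → i ≠ j →
      col x i = 0) → Pi.single j 1 ∈ LinearMap.range X.mulVecLin := by
    intro x j hjj h1 h0
    have hmem : col x - ∑ i ∈ Finset.univ.filter (fun i ↦ i ≠ j₁ ∧ i ≠ j₂),
        col x i • Pi.single (M := fun _ ↦ ℤ) i 1 ∈ LinearMap.range X.mulVecLin := by
      refine Submodule.sub_mem _ (hcol x) (Submodule.sum_mem _ fun i hi ↦ ?_)
      rw [Finset.mem_filter] at hi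
      exact Submodule.smul_mem _ _ (hsingle i hi.2.1 hi.2.2)
    convert hmem using 1
    ext i
    have hsum : (∑ k ∈ Finset.univ.filter (fun k ↦ k ≠ j₁ ∧ k ≠ j₂),
        col x k • Pi.single (M := fun _ ↦ ℤ) k 1) i = if i ≠ j₁ ∧ i ≠ j₂ then col x i else 0 := by
      simp [Finset.sum_apply, Pi.single_apply]
    rw [Pi.sub_apply, hsum]
    by_cases hi : i ≠ j₁ ∧ i ≠ j₂
    · have : i ≠ j := by
        rintro rfl
        exact hjj.elim hi.1 hi.2
      simp [hi, this]
    · rw [if_neg hi, sub_zero]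
      rcases eq_or_ne i j with rfl | hij
      · simp [h1]
      · rw [Pi.single_eq_of_ne hij, h0 i (by tauto) hij]
  have hall : ∀ j, Pi.single j 1 ∈ LinearMap.range X.mulVecLin := by
    intro j
    by_cases h1 : j = j₁
    · subst h1
      refine hdouble (d j).fst j (Or.inl rfl) (hone j) fun i hi hij ↦ ?_
      obtain rfl := hi.resolve_left hij
      have := hzero i
      rwa [hj] at this
    · by_cases h2 : j = j₂
      · subst h2
        refine hdouble (d j).fst j (Or.inr rfl) (hone j) fun i hi hij ↦ ?_
        obtain rfl := hi.resolve_right hij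
        have := hzero i
        rwa [hj]
      · exact hsingle j h1 h2
  rw [← Matrix.mulVec_surjective_iff_isUnit]
  intro y
  have : y ∈ LinearMap.range X.mulVecLin := by
    rw [pi_eq_sum_univ' y]
    refine Submodule.sum_mem _ fun j _ ↦ Submodule.smul_mem _ _ ?_
    convert hall j using 1
  exact this

lemma mem_catalystClass [Fintype V] {S : Finset V} {A : Arrowflow T S.card}
    {κ : Equiv.Perm S × (S → T.Dart)} :
    κ ∈ catalystClass T S A ↔ IsCatalyst T S κ ∧ inducedArcs T S κ = (A : Multiset T.Dart) := by
  classical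
  rw [catalystClass, Finset.mem_filter, and_iff_right (Finset.mem_univ _)]

lemma sum_sign_catalystClass [Fintype V] [DecidableEq V] (hT : T.IsTree) {S : Finset V}
    (A : Arrowflow T S.card) (hA : (A : Multiset T.Dart).Nodup) {d : S → T.Dart}
    (hd : Function.Injective d) (hdA : ∀ a, a ∈ (A : Multiset T.Dart) ↔ ∃ j, d j = a) :
    ∑ κ ∈ catalystClass T S A, ((Equiv.Perm.sign κ.1 : ℤˣ) : ℤ) =
      (tailMatrix d (fun s : S ↦ (s : V))).det *
        (Matrix.of fun i j ↦ 1 - tailMatrix d (fun s : S ↦ (s : V)) i j).det := by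
  classical
  rw [det_mul_det_eq_sum, ← Fintype.sum_prod_type'
    (f := fun π σ : Equiv.Perm S ↦ (Equiv.Perm.sign σ : ℤ) * ∏ i, (tailMatrix d _ (π i) i *
      (Matrix.of fun i j ↦ 1 - tailMatrix d (fun s : S ↦ (s : V)) i j) (π i) (σ i)))]
  have hterm : ∀ q : Equiv.Perm S × Equiv.Perm S,
      (Equiv.Perm.sign q.2 : ℤ) * ∏ i, (tailMatrix d (fun s : S ↦ (s : V)) (q.1 i) i *
      (Matrix.of fun i j ↦ 1 - tailMatrix d (fun s : S ↦ (s : V)) i j) (q.1 i) (q.2 i)) =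
      if IsCatalyst T S (q.2, fun i ↦ d (q.1 i)) then (Equiv.Perm.sign q.2 : ℤ) else 0 := by
    intro q
    have hprod : ∀ i, (tailMatrix d (fun s : S ↦ (s : V)) (q.1 i) i *
        (Matrix.of fun i j ↦ 1 - tailMatrix d (fun s : S ↦ (s : V)) i j) (q.1 i) (q.2 i)) =
        if TailSide T (d (q.1 i)) i ∧ ¬ TailSide T (d (q.1 i)) (q.2 i) then 1 else 0 := by
      intro i
      simp only [tailMatrix, Matrix.of_apply]
      split_ifs <;> simp_all
    rw [Finset.prod_congr rfl fun i _ ↦ hprod i, Finset.prod_ite_zero]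
    simp [IsCatalyst, exists_isPath_mem_darts_iff hT]
  rw [Finset.sum_congr rfl fun q _ ↦ hterm q, ← Finset.sum_filter]
  symm
  refine Finset.sum_bij (fun q _ ↦ (q.2, fun i ↦ d (q.1 i))) ?_ ?_ ?_ ?_
  · intro q hq
    rw [Finset.mem_filter] at hq
    rw [mem_catalystClass]
    refine ⟨hq.2, ?_⟩
    have hinj : Function.Injective fun i ↦ d (q.1 i) := hd.comp q.1.injective
    rw [inducedArcs, Multiset.Nodup.ext (Finset.univ.nodup.map hinj) hA]
    intro a
    rw [hdA, Multiset.mem_map]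
    constructor
    · rintro ⟨i, -, rfl⟩
      exact ⟨_, rfl⟩
    · rintro ⟨j, rfl⟩
      exact ⟨q.1.symm j, Finset.mem_univ _, by simp⟩
  · intro q _ q' _ h
    rw [Prod.mk.injEq] at h
    exact Prod.ext (Equiv.ext fun i ↦ hd (congrFun h.2 i)) h.1
  · rintro ⟨σ, f⟩ hκ
    obtain ⟨hc, hf⟩ := mem_catalystClass.1 hκ
    have hmem : ∀ i, ∃ j, d j = f i := fun i ↦ by
      rw [← hdA, ← hf]
      exact Multiset.mem_map_of_mem _ (Finset.mem_univ i)
    choose g hg using hmem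
    -- Since `A` has no repeated arc, `f` is injective and so is `d` composed with a permutation.
    have hfinj : Function.Injective f := fun i j h ↦
      Multiset.inj_on_of_nodup_map (hf ▸ hA : (inducedArcs T S (σ, f)).Nodup) i
        (Finset.mem_univ i) j (Finset.mem_univ j) h
    have hginj : Function.Injective g := fun i j h ↦ hfinj (by rw [← hg, ← hg, h])
    have hfg : (fun i ↦ d (Equiv.ofBijective g (Finite.injective_iff_bijective.1 hginj) i)) = f :=
      funext hg
    refine ⟨(Equiv.ofBijective g (Finite.injective_iff_bijective.1 hginj), σ), ?_, ?_⟩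
    · simpa only [Finset.mem_filter, Finset.mem_univ, true_and, hfg] using hc
    · rw [hfg]
  · intro q _
    rfl

lemma card_image_edge_of_missingForest [Finite V] [DecidableEq V] (hT : T.IsTree) {S : Finset V}
    {D : Finset T.Dart} {F : SimpleGraph V} (hF : IsRootedForest T S F)
    (hD : (D.image Dart.edge : Set (Sym2 V)) = T.edgeSet \ F.edgeSet) :
    (D.image Dart.edge).card + 1 = S.card := by
  rw [← card_edgeSet_sdiff_of_isRootedForest hT hF, ← hD, Set.ncard_coe_finset]

lemma missingForest_eq_iff {F : SimpleGraph V} (hF : F ≤ T) {k : ℕ} (A : Arrowflow T k) :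
    missingForest T A = F ↔
      {e | ∃ a : T.Dart, a ∈ (A : Multiset T.Dart) ∧ a.edge = e} = T.edgeSet \ F.edgeSet := by
  have hsub : {e | ∃ a : T.Dart, a ∈ (A : Multiset T.Dart) ∧ a.edge = e} ⊆ T.edgeSet := by
    rintro _ ⟨a, -, rfl⟩
    exact a.edge_mem
  rw [← edgeSet_inj, edgeSet_missingForest]
  constructor
  · intro h
    rw [← h, Set.sdiff_sdiff_cancel_left hsub]
  · intro h
    rw [h, Set.sdiff_sdiff_cancel_left (edgeSet_mono hF)]

theorem sum_sign_of_isUnital [Fintype V] [DecidableEq V] (hT : T.IsTree) {S : Finset V}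
    (A : Arrowflow T S.card) (hA : IsUnital T S A) :
    ∑ κ ∈ catalystClass T S A, ((Equiv.Perm.sign κ.1 : ℤˣ) : ℤ) = (-1 : ℤ) ^ (S.card - 1) := by
  classical
  obtain ⟨hnd, hF⟩ := hA
  rw [not_hasParallelArrows_iff] at hnd
  have hmf := (missingForest_eq_iff hF.le A).1 rfl
  let D : Finset T.Dart := ⟨A, hnd⟩
  have hDc : D.card = S.card := A.2
  have himg : (D.image Dart.edge : Set (Sym2 V)) =
      T.edgeSet \ (missingForest T A).edgeSet := by
    rw [← hmf]
    ext e
    simp [D]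
  have hcard := card_image_edge_of_missingForest hT hF himg
  obtain ⟨a, ha, ha', hD⟩ := exists_symm_mem_of_card_image_edge (hcard.trans hDc.symm)
  let e : S ≃ D := Finset.equivOfCardEq hDc.symm
  let d : S → T.Dart := fun j ↦ e j
  have hd : Function.Injective d := Subtype.val_injective.comp e.injective
  have hdD : ∀ j, d j ∈ D := fun j ↦ (e j).2
  have hdA : ∀ b, b ∈ (A : Multiset T.Dart) ↔ ∃ j, d j = b := fun b ↦
    ⟨fun hb ↦ ⟨e.symm ⟨b, hb⟩, by simp [d]⟩, by rintro ⟨j, rfl⟩; exact hdD j⟩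
  obtain ⟨j₁, hj₁⟩ := (hdA a).1 ha
  obtain ⟨j₂, hj₂⟩ := (hdA a.symm).1 ha'
  have hj : d j₂ = (d j₁).symm := by rw [hj₁, hj₂]
  have hunit := isUnit_tailMatrix hT hF hd (fun j hjF ↦ by
      have : (d j).edge ∈ (D.image Dart.edge : Set (Sym2 V)) :=
        Finset.mem_coe.2 (Finset.mem_image_of_mem _ (hdD j))
      rw [himg] at this
      exact this.2 hjF) hj (fun j h1 h2 i hi ↦
        hD (d j) (hdD j) (fun h ↦ h1 (hd (h.trans hj₁.symm)))
          (fun h ↦ h2 (hd (h.trans hj₂.symm))) (hi ▸ hdD i))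
  rw [sum_sign_catalystClass hT A hnd hd hdA, det_one_sub_of_row_add_row (a := j₁) (b := j₂)]
  -- An integer unit squares to 1, which removes `det X` from the formula.
  · have hsq := Int.units_mul_self ((Matrix.isUnit_iff_isUnit_det _).1 hunit).unit
    rw [Units.ext_iff, Units.val_mul, IsUnit.unit_spec, Units.val_one] at hsq
    rw [mul_left_comm, hsq, mul_one, Fintype.card_coe]
  · intro s
    simp only [tailMatrix, Matrix.of_apply, hj, tailSide_symm hT]
    split_ifs <;> simp_all

end Arrowflow

/-! ### Counting unital arrowflows with a given missing forest. -/

section Count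

variable {V : Type*} {T : SimpleGraph V}

lemma card_finset_dart_image_edge [Fintype V] [DecidableEq V] [Fintype T.Dart]
    {E : Finset (Sym2 V)} (hE : (E : Set (Sym2 V)) ⊆ T.edgeSet) (hne : E.Nonempty) :
    (Finset.univ.filter fun D : Finset T.Dart ↦
      D.image Dart.edge = E ∧ D.card = E.card + 1).card = E.card * 2 ^ (E.card - 1) := by
  classical
  have hor : ∀ e, e ∈ E → ∃ a : T.Dart, a.edge = e := by
    intro e he
    have := hE he
    induction e with | _ u v
    exact ⟨⟨(u, v), this⟩, rfl⟩
  have : Nonempty T.Dart := let ⟨e, he⟩ := hne; (hor e he).nonempty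
  -- `o` fixes a reference orientation of each edge in `E`.
  choose! o ho using hor
  have hinj : ∀ x ∈ E, ∀ y ∈ E, o x = o y → x = y := fun x hx y hy h ↦ by
    rw [← ho x hx, h, ho y hy]
  have hinjs : ∀ x ∈ E, ∀ y ∈ E, (o x).symm = (o y).symm → x = y := fun x hx y hy h ↦
    hinj x hx y hy (Dart.symm_involutive.injective h)
  have hne' : ∀ x ∈ E, ∀ y ∈ E, (o x).symm ≠ o y := by
    intro x hx y hy h
    have hxy : x = y := by rw [← ho x hx, ← Dart.edge_symm, h, ho y hy]
    subst hxy
    exact (o x).symm_ne h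
  have hcase : ∀ a : T.Dart, a.edge ∈ E → a = o a.edge ∨ a = (o a.edge).symm := fun a ha ↦
    (dart_edge_eq_iff _ _).1 (ho _ ha).symm
  -- `p.1` is the doubled edge and `p.2` the set of edges used only in reverse; `p.1 ∉ p.2`, so
  -- `p.1` contributes both darts.
  let f : (Σ _ : Sym2 V, Finset (Sym2 V)) → Finset T.Dart := fun p ↦
    (E \ p.2).image o ∪ (insert p.1 p.2).image fun x ↦ (o x).symm
  have hdom : ∀ p ∈ E.sigma fun e ↦ (E.erase e).powerset, p.1 ∈ E ∧ p.2 ⊆ E ∧ p.1 ∉ p.2 := by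
    intro p hp
    rw [Finset.mem_sigma, Finset.mem_powerset, Finset.subset_erase] at hp
    exact hp
  have hmem : ∀ p ∈ E.sigma fun e ↦ (E.erase e).powerset, ∀ x ∈ E,
      (o x ∈ f p ↔ x ∉ p.2) ∧ ((o x).symm ∈ f p ↔ x = p.1 ∨ x ∈ p.2) := by
    intro p hp x hx
    obtain ⟨h1, h2, h3⟩ := hdom p hp
    have hins : ∀ y ∈ insert p.1 p.2, y ∈ E := fun y hy ↦
      (Finset.mem_insert.1 hy).elim (fun h ↦ h ▸ h1) (fun h ↦ h2 h)
    simp only [f, Finset.mem_union, Finset.mem_image, Finset.mem_sdiff]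
    constructor
    · constructor
      · rintro (⟨y, ⟨hy, hyp⟩, h⟩ | ⟨y, hy, h⟩)
        · rwa [← hinj y hy x hx h]
        · exact absurd h (hne' y (hins y hy) x hx)
      · exact fun h ↦ Or.inl ⟨x, ⟨hx, h⟩, rfl⟩
    · rw [← Finset.mem_insert]
      constructor
      · rintro (⟨y, ⟨hy, hyp⟩, h⟩ | ⟨y, hy, h⟩)
        · exact absurd h.symm (hne' x hx y hy)
        · rwa [← hinjs y (hins y hy) x hx h]
      · exact fun h ↦ Or.inr ⟨x, h, rfl⟩
  have hcard : (E.sigma fun e ↦ (E.erase e).powerset).card = E.card * 2 ^ (E.card - 1) := by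
    rw [Finset.card_sigma, Finset.sum_congr rfl fun e he ↦ by
      rw [Finset.card_powerset, Finset.card_erase_of_mem he], Finset.sum_const, smul_eq_mul]
  rw [← hcard]
  symm
  refine Finset.card_bij (fun p _ ↦ f p) ?_ ?_ ?_
  · intro p hp
    obtain ⟨h1, h2, h3⟩ := hdom p hp
    have hins : insert p.1 p.2 ⊆ E := Finset.insert_subset h1 h2
    rw [Finset.mem_filter]
    refine ⟨Finset.mem_univ _, ?_, ?_⟩
    · ext e
      rw [Finset.mem_image]
      constructor
      · rintro ⟨a, ha, rfl⟩
        rw [Finset.mem_union, Finset.mem_image, Finset.mem_image] at ha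
        rcases ha with ⟨x, hx, rfl⟩ | ⟨x, hx, rfl⟩
        · rw [ho x (Finset.mem_sdiff.1 hx).1]
          exact (Finset.mem_sdiff.1 hx).1
        · rw [Dart.edge_symm, ho x (hins hx)]
          exact hins hx
      · intro he
        by_cases hep : e ∈ p.2
        · exact ⟨(o e).symm, (hmem p hp e he).2.2 (Or.inr hep), by rw [Dart.edge_symm, ho e he]⟩
        · exact ⟨o e, (hmem p hp e he).1.2 hep, ho e he⟩
    · rw [Finset.card_union_of_disjoint, Finset.card_image_of_injOn, Finset.card_image_of_injOn,
        Finset.card_insert_of_notMem h3, Finset.card_sdiff_of_subset h2]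
      · have := Finset.card_le_card h2
        omega
      · exact fun x hx y hy h ↦ hinjs x (hins hx) y (hins hy) h
      · exact fun x hx y hy h ↦
          hinj x (Finset.mem_sdiff.1 hx).1 y (Finset.mem_sdiff.1 hy).1 h
      · rw [Finset.disjoint_left]
        intro a ha ha'
        obtain ⟨x, hx, rfl⟩ := Finset.mem_image.1 ha
        obtain ⟨y, hy, h⟩ := Finset.mem_image.1 ha'
        exact hne' y (hins hy) x (Finset.mem_sdiff.1 hx).1 h
  · rintro p hp q hq hpq
    obtain ⟨h1, h2, h3⟩ := hdom p hp
    obtain ⟨h1', h2', h3'⟩ := hdom q hq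
    have hB : p.2 = q.2 := by
      ext x
      by_cases hx : x ∈ E
      · have ha := (hmem p hp x hx).1
        have hb := (hmem q hq x hx).1
        rw [hpq] at ha
        exact not_iff_not.1 (ha.symm.trans hb)
      · exact ⟨fun h ↦ absurd (h2 h) hx, fun h ↦ absurd (h2' h) hx⟩
    have he : p.1 = q.1 := by
      have ha := (hmem p hp p.1 h1).2.2 (Or.inl rfl)
      rw [hpq] at ha
      exact ((hmem q hq p.1 h1).2.1 ha).resolve_right (hB ▸ h3)
    exact Sigma.ext he (heq_of_eq hB)
  · intro D hD
    obtain ⟨-, himg, hDc⟩ := Finset.mem_filter.1 hD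
    obtain ⟨a, ha, ha', hu⟩ := exists_symm_mem_of_card_image_edge (D := D) (by rw [himg, hDc])
    have hDE : ∀ c ∈ D, c.edge ∈ E := fun c hc ↦ himg ▸ Finset.mem_image_of_mem _ hc
    have hoa : o a.edge ∈ D ∧ (o a.edge).symm ∈ D := by
      rcases hcase a (hDE a ha) with h | h
      · exact ⟨h ▸ ha, h ▸ ha'⟩
      · refine ⟨?_, h ▸ ha⟩
        have : o a.edge = a.symm := by
          conv_rhs => rw [h, Dart.symm_symm]
        rwa [this]
    -- The preimage of `D`: its doubled edge, and the edges whose reference dart is absent.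
    have hp : (⟨a.edge, E.filter fun x ↦ o x ∉ D⟩ : Σ _ : Sym2 V, Finset (Sym2 V)) ∈
        E.sigma fun e ↦ (E.erase e).powerset := by
      rw [Finset.mem_sigma, Finset.mem_powerset, Finset.subset_erase]
      exact ⟨hDE a ha, Finset.filter_subset _ _, fun h ↦ (Finset.mem_filter.1 h).2 hoa.1⟩
    refine ⟨_, hp, ?_⟩
    have hout : ∀ x ∈ E, (o x ∈ D ↔ x ∉ E.filter fun x ↦ o x ∉ D) ∧
        ((o x).symm ∈ D ↔ x = a.edge ∨ x ∈ E.filter fun x ↦ o x ∉ D) := by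
      intro x hx
      rw [Finset.mem_filter]
      refine ⟨by tauto, fun h ↦ ?_, ?_⟩
      · by_contra! hcon
        have hox : o x ∈ D := by tauto
        refine hu _ hox ?_ ?_ h
        · rintro rfl
          exact hcon.1 (ho x hx).symm
        · intro h'
          refine hcon.1 ?_
          rw [← a.edge_symm, ← h', ho x hx]
      · rintro (rfl | ⟨-, h⟩)
        · exact hoa.2
        · rw [← himg, Finset.mem_image] at hx
          obtain ⟨c, hc, rfl⟩ := hx
          rcases hcase c (hDE c hc) with h' | h'
          · exact absurd (h' ▸ hc) h
          · exact h' ▸ hc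
    have hfE : ∀ c ∈ f ⟨a.edge, E.filter fun x ↦ o x ∉ D⟩, c.edge ∈ E := by
      intro c hc
      rcases Finset.mem_union.1 hc with hc | hc
      · obtain ⟨x, hx, rfl⟩ := Finset.mem_image.1 hc
        rw [ho x (Finset.mem_sdiff.1 hx).1]
        exact (Finset.mem_sdiff.1 hx).1
      · obtain ⟨x, hx, rfl⟩ := Finset.mem_image.1 hc
        have hxE : x ∈ E := (Finset.mem_insert.1 hx).elim (fun h ↦ h ▸ hDE a ha)
          fun h ↦ (Finset.mem_filter.1 h).1
        rwa [Dart.edge_symm, ho x hxE]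
    have key : ∀ c : T.Dart, c.edge ∈ E →
        (c ∈ f ⟨a.edge, E.filter fun x ↦ o x ∉ D⟩ ↔ c ∈ D) := by
      intro c hc
      rcases hcase c hc with h | h
      · rw [h]
        exact (hmem _ hp _ hc).1.trans (hout _ hc).1.symm
      · rw [h]
        exact (hmem _ hp _ hc).2.trans (hout _ hc).2.symm
    ext c
    exact ⟨fun h ↦ (key c (hfE c h)).1 h, fun h ↦ (key c (hDE c h)).2 h⟩

theorem card_unital_missingForest_eq [Fintype V] [DecidableEq V] (hT : T.IsTree) {S : Finset V}
    (hS : 2 ≤ S.card) {F : SimpleGraph V} (hF : IsRootedForest T S F) :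
    Nat.card {A : Arrowflow T S.card // IsUnital T S A ∧ missingForest T A = F} =
      (S.card - 1) * 2 ^ (S.card - 2) := by
  classical
  have hcard := card_edgeSet_sdiff_of_isRootedForest hT hF
  let E : Finset (Sym2 V) := (T.edgeSet \ F.edgeSet).toFinset
  have hE : (E : Set (Sym2 V)) = T.edgeSet \ F.edgeSet := Set.coe_toFinset _
  have hEc : E.card + 1 = S.card := by rw [← hcard, ← hE, Set.ncard_coe_finset]
  have hiff : ∀ A : Arrowflow T S.card, IsUnital T S A ∧ missingForest T A = F ↔
      ∃ h : (A : Multiset T.Dart).Nodup, (⟨A, h⟩ : Finset T.Dart).image Dart.edge = E := by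
    intro A
    have hset : ∀ h : (A : Multiset T.Dart).Nodup,
        (⟨A, h⟩ : Finset T.Dart).image Dart.edge = E ↔ missingForest T A = F := by
      intro h
      rw [missingForest_eq_iff hF.le, ← hE, ← Finset.coe_inj]
      refine Eq.to_iff (congrArg (· = (E : Set (Sym2 V))) ?_)
      ext e
      simp
    rw [IsUnital, not_hasParallelArrows_iff]
    constructor
    · rintro ⟨⟨h, -⟩, h'⟩
      exact ⟨h, (hset h).2 h'⟩
    · rintro ⟨h, h'⟩
      have hm := (hset h).1 h'
      exact ⟨⟨h, hm.symm ▸ hF⟩, hm⟩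
  let e : {A : Arrowflow T S.card // IsUnital T S A ∧ missingForest T A = F} ≃
      (Finset.univ.filter fun D : Finset T.Dart ↦
        D.image Dart.edge = E ∧ D.card = E.card + 1) :=
    { toFun := fun A ↦ ⟨⟨A.1, ((hiff A.1).1 A.2).1⟩, Finset.mem_filter.2
        ⟨Finset.mem_univ _, ((hiff A.1).1 A.2).2, A.1.2.trans hEc.symm⟩⟩
      invFun := fun D ↦ ⟨⟨D.1.val, (Finset.mem_filter.1 D.2).2.2.trans hEc⟩,
        (hiff _).2 ⟨D.1.nodup, (Finset.mem_filter.1 D.2).2.1⟩⟩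
      left_inv := fun _ ↦ rfl
      right_inv := fun _ ↦ rfl }
  -- Here `E` has `m - 1` elements, and `2 ≤ m` makes it nonempty.
  rw [Nat.card_congr e, Nat.card_eq_fintype_card, Fintype.card_coe,
    card_finset_dart_image_edge (hE ▸ Set.sdiff_subset) (Finset.card_pos.1 (by omega))]
  rw [← hEc]
  rfl

end Count

end TreeCatalyst

theorem proposition4p2 {V : Type*} [Fintype V] [DecidableEq V] (T : SimpleGraph V)
    (hT : T.IsTree) (S : Finset V) (hS : 2 ≤ S.card) :
    (∀ A : TreeCatalyst.Arrowflow T S.card, TreeCatalyst.IsUnital T S A →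
      ∑ κ ∈ TreeCatalyst.catalystClass T S A, ((Equiv.Perm.sign κ.1 : ℤˣ) : ℤ)
        = (-1 : ℤ) ^ (S.card - 1)) ∧
    (∀ F : SimpleGraph V, TreeCatalyst.IsRootedForest T S F →
      Nat.card {A : TreeCatalyst.Arrowflow T S.card //
          TreeCatalyst.IsUnital T S A ∧ TreeCatalyst.missingForest T A = F}
        = (S.card - 1) * 2 ^ (S.card - 2)) :=
  ⟨fun A hA ↦ TreeCatalyst.sum_sign_of_isUnital hT A hA,
    fun _ hF ↦ TreeCatalyst.card_unital_missingForest_eq hT hS hF⟩
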